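/- Let $\mathbb D=\{z\in\mathbb C:|z|<1\}$ and let $f$ be a convex harmonic mapping of $\mathbb D$, that is, a complex-valued harmonic function in $\mathbb D$ that is injective in $\mathbb D$ and whose image $f(\mathbb D)$ is convex. Write $f=h+\overline g$ with $h,g$ analytic in $\mathbb D$. Then the Jacobian $J_f=|h'|^2-|g'|^2$ does not vanish in $\mathbb D$, so that the Schwarzian derivative $S_f$ is defined in $\mathbb D$: if $J_f>0$, then, with $\omega=g'/h'$ and $Sh=(h''/h')'-\frac12(h''/h')^2$, $$S_f=Sh+\frac{\overline\omega}{1-|\omega|^2}\left(\frac{h''}{h'}\,\omega'-\omega''\right)-\frac32\left(\frac{\omega'\,\overline\omega}{1-|\omega|^2}\right)^2,$$ and if $J_f<0$, then $S_f=S_{\overline f}$, where $\overline f=g+\overline h$. Moreover, $$\|S_f\|=\sup_{z\in\mathbb D}|S_f(z)|\,(1-|z|^2)^2\le 6 .$$ -/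

import Mathlib

namespace HarmonicSchwarzian

/-- `f` is a convex harmonic mapping of the unit disk: it is harmonic there, univalent there, and
the image of the unit disk is a convex set. It may be sense-preserving or sense-reversing. -/
structure IsConvexHarmonicMapping (f : ℂ → ℂ) : Prop where
  harmonic : InnerProductSpace.HarmonicOnNhd f (Metric.ball (0 : ℂ) 1)
  univalent : Set.InjOn f (Metric.ball (0 : ℂ) 1)
  convex_image : Convex ℝ (f '' Metric.ball (0 : ℂ) 1)

/-- `f = h + conj g` in the unit disk with `h` and `g` analytic. (For a given harmonic `f` the pair
is unique up to an additive constant, on which nothing below depends.) -/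
structure IsRepresentation (f h g : ℂ → ℂ) : Prop where
  analytic_left : DifferentiableOn ℂ h (Metric.ball (0 : ℂ) 1)
  analytic_right : DifferentiableOn ℂ g (Metric.ball (0 : ℂ) 1)
  eq_add_conj : ∀ z ∈ Metric.ball (0 : ℂ) 1, f z = h z + (starRingEnd ℂ) (g z)

/-- The Jacobian `|h'|² - |g'|²` of `h + conj g`. -/
noncomputable def jacobian (h g : ℂ → ℂ) (z : ℂ) : ℝ :=
  ‖deriv h z‖ ^ 2 - ‖deriv g z‖ ^ 2

/-- The classical pre-Schwarzian derivative `h'' / h'`. -/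
noncomputable def preSchwarzian (h : ℂ → ℂ) (z : ℂ) : ℂ :=
  deriv (deriv h) z / deriv h z

/-- The classical Schwarzian derivative `(Ph)' - (Ph)² / 2`. -/
noncomputable def classicalSchwarzian (h : ℂ → ℂ) (z : ℂ) : ℂ :=
  deriv (preSchwarzian h) z - 1 / 2 * preSchwarzian h z ^ 2

/-- The (second complex) dilatation `ω = g' / h'` of `h + conj g`. -/
noncomputable def dilatation (h g : ℂ → ℂ) (z : ℂ) : ℂ :=
  deriv g z / deriv h z

/-- The Schwarzian derivative of a sense-preserving harmonic mapping `h + conj g`: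
`Sh + ω̄ / (1 - |ω|²) * (h'' / h' * ω' - ω'') - 3/2 * (ω' ω̄ / (1 - |ω|²))²`. -/
noncomputable def sensePreservingSchwarzian (h g : ℂ → ℂ) (z : ℂ) : ℂ :=
  classicalSchwarzian h z
    + (starRingEnd ℂ) (dilatation h g z) / (1 - (‖dilatation h g z‖ : ℂ) ^ 2)
      * (preSchwarzian h z * deriv (dilatation h g) z - deriv (deriv (dilatation h g)) z)
    - 3 / 2 * (deriv (dilatation h g) z * (starRingEnd ℂ) (dilatation h g z)
      / (1 - (‖dilatation h g z‖ : ℂ) ^ 2)) ^ 2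

open Classical in
/-- The Schwarzian derivative of a locally univalent harmonic mapping `f = h + conj g`: where the
Jacobian is negative it is that of the sense-preserving mapping `conj f = g + conj h`. -/
noncomputable def schwarzian (h g : ℂ → ℂ) (z : ℂ) : ℂ :=
  if 0 < jacobian h g z then sensePreservingSchwarzian h g z else sensePreservingSchwarzian g h z

/-- The Schwarzian norm `sup_{|z| < 1} |S_f(z)| (1 - |z|²)²`, as an element of `[0, ∞]`. -/
noncomputable def schwarzianNorm (h g : ℂ → ℂ) : ENNReal :=
  ⨆ z ∈ Metric.ball (0 : ℂ) 1, ENNReal.ofReal (‖schwarzian h g z‖ * (1 - ‖z‖ ^ 2) ^ 2)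

end HarmonicSchwarzian

/-!
By Lewy's theorem the Jacobian of the univalent harmonic mapping `f = h + conj g` has no zero, so it
has constant sign, and `conj f` may replace `f` if the sign is negative. When the image is convex,
`h + a g` is univalent for every `a` with `|a| < 1` (Clunie and Sheil-Small). For `a = -conj ω(z₀)`
the Schwarzian derivative of `f` at `z₀` is the classical one of `h + a g` at `z₀`, so everything
reduces to the bound `|SF| (1 - |z|²)² ≤ 6` of Kraus and Nehari for univalent analytic `F`.

An automorphism of the disk moves the point to `0`. Writing `F = F(0) + F'(0) z / (1 + z P)` one
finds `SF(0) = -6 P'(0)`, and `|P'(0)| ≤ 1` is the area theorem for the univalent function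
`z⁻¹ + P`. In place of Green's formula, the area theorem uses that `z⁻¹ + P` maps `|z| = r` nearly
onto an ellipse, which the real-linear map `w ↦ w - P'(0) r² conj w` makes nearly a circle (after
normalizing `P(0) = 0`): comparing areas and letting `r → 0` gives the bound.
-/

namespace HarmonicSchwarzian

open Filter Metric Set Topology Complex MeasureTheory
open scoped ComplexConjugate

variable {h g : ℂ → ℂ} {z : ℂ}

/-! ### The differential of a harmonic mapping -/

/-- The real-linear map `d ↦ α d + β conj d`, that is, the differential of a map whose Wirtinger
derivatives `∂f` and `∂̄f` are `α` and `β`. -/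
noncomputable def wirtingerCLM (α β : ℂ) : ℂ →L[ℝ] ℂ :=
  ContinuousLinearMap.mul ℝ ℂ α + (ContinuousLinearMap.mul ℝ ℂ β).comp (conjCLE : ℂ →L[ℝ] ℂ)

@[simp]
theorem wirtingerCLM_apply (α β d : ℂ) : wirtingerCLM α β d = α * d + β * conj d := by
  simp [wirtingerCLM]

theorem det_wirtingerCLM (α β : ℂ) : (wirtingerCLM α β).det = ‖α‖ ^ 2 - ‖β‖ ^ 2 := by
  rw [ContinuousLinearMap.det, ← LinearMap.det_toMatrix basisOneI, Matrix.det_fin_two]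
  simp only [LinearMap.toMatrix_apply, ContinuousLinearMap.coe_coe, wirtingerCLM_apply,
    coe_basisOneI, coe_basisOneI_repr, Matrix.cons_val_zero, Matrix.cons_val_one,
    ← normSq_eq_norm_sq, normSq_apply, map_one, conj_I, add_re, add_im, mul_re, mul_im, one_re,
    one_im, I_re, I_im, neg_re, neg_im]
  ring

theorem det_wirtingerCLM_deriv_eq_jacobian (h g : ℂ → ℂ) (z : ℂ) :
    (wirtingerCLM (deriv h z) (conj (deriv g z))).det = jacobian h g z := by
  rw [det_wirtingerCLM, RCLike.norm_conj, jacobian]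

theorem wirtingerCLM_injective {α β : ℂ} (hαβ : ‖α‖ ≠ ‖β‖) :
    Function.Injective (wirtingerCLM α β) := by
  have hdet : (wirtingerCLM α β).det ≠ 0 := by
    rw [det_wirtingerCLM, sub_ne_zero]
    exact fun h => hαβ ((sq_eq_sq₀ (norm_nonneg _) (norm_nonneg _)).1 h)
  exact ((wirtingerCLM α β).toContinuousLinearEquivOfDetNeZero hdet).injective

theorem hasStrictFDerivAt_add_conj (hh : AnalyticAt ℂ h z) (hg : AnalyticAt ℂ g z) :
    HasStrictFDerivAt (fun z => h z + conj (g z))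
      (wirtingerCLM (deriv h z) (conj (deriv g z))) z := by
  have hh' := hh.hasStrictDerivAt.hasStrictFDerivAt.restrictScalars ℝ
  have hg' := hg.hasStrictDerivAt.hasStrictFDerivAt.restrictScalars ℝ
  refine (hh'.add ((conjCLE : ℂ →L[ℝ] ℂ).hasStrictFDerivAt.comp z hg')).congr_fderiv ?_
  ext d; simp [mul_comm]

theorem measureReal_image_add_conj {A : Set ℂ} (hA : MeasurableSet A) (hh : AnalyticOnNhd ℂ h A)
    (hg : AnalyticOnNhd ℂ g A) (hinj : InjOn (fun z => h z + conj (g z)) A) :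
    volume.real ((fun z => h z + conj (g z)) '' A) = ∫ z in A, |jacobian h g z| := by
  have hderiv : ∀ z ∈ A, HasFDerivWithinAt (fun z => h z + conj (g z))
      (wirtingerCLM (deriv h z) (conj (deriv g z))) A z := fun z hz =>
    (hasStrictFDerivAt_add_conj (hh z hz) (hg z hz)).hasFDerivAt.hasFDerivWithinAt
  simpa [det_wirtingerCLM_deriv_eq_jacobian] using
    integral_image_eq_integral_abs_det_fderiv_smul volume hA hderiv hinj fun _ => (1 : ℝ)

/-! ### Lewy's theorem -/

theorem exists_analyticAt_pow_eq {w : ℂ → ℂ} {z₀ : ℂ} (hw : AnalyticAt ℂ w z₀) (hw0 : w z₀ ≠ 0)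
    {n : ℕ} (hn : n ≠ 0) :
    ∃ r : ℂ → ℂ, AnalyticAt ℂ r z₀ ∧ ∀ z, r z ^ n = w z := by
  obtain ⟨c, hc⟩ := IsAlgClosed.exists_pow_nat_eq (w z₀) hn.pos
  have hq : AnalyticAt ℂ (fun z => w z / w z₀) z₀ := hw.fun_div analyticAt_const hw0
  refine ⟨fun z => c * (w z / w z₀) ^ ((n : ℂ)⁻¹),
    analyticAt_const.fun_mul (hq.cpow analyticAt_const ?_), fun z => ?_⟩
  · simp [div_self hw0]
  · rw [mul_pow, hc, cpow_nat_inv_pow _ hn, mul_div_cancel₀ _ hw0]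

theorem exists_openPartialHomeomorph_eq_add_pow {φ : ℂ → ℂ} {z₀ : ℂ} (hφ : AnalyticAt ℂ φ z₀)
    (hord : analyticOrderAt (φ · - φ z₀) z₀ ≠ ⊤) :
    ∃ e : OpenPartialHomeomorph ℂ ℂ, z₀ ∈ e.source ∧ e z₀ = 0 ∧
      ∀ z ∈ e.source, φ z = φ z₀ + e z ^ analyticOrderNatAt (φ · - φ z₀) z₀ := by
  have hφ₀ : AnalyticAt ℂ (φ · - φ z₀) z₀ := hφ.fun_sub analyticAt_const
  set n := analyticOrderNatAt (φ · - φ z₀) z₀ with hn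
  obtain ⟨w, hw, hw0, hfac⟩ := hφ₀.analyticOrderAt_ne_top.1 hord
  have hn0 : n ≠ 0 := by
    rw [hn, ← Nat.cast_ne_zero (R := ℕ∞), Nat.cast_analyticOrderNatAt hord,
      hφ₀.analyticOrderAt_ne_zero, sub_self]
  obtain ⟨r, hr, hrn⟩ := exists_analyticAt_pow_eq hw hw0 hn0
  have hr0 : r z₀ ≠ 0 := by
    rw [← hrn] at hw0
    exact ne_zero_pow hn0 hw0
  have hψ : HasStrictDerivAt (fun z => (z - z₀) * r z) (r z₀) z₀ := by
    have hsub : HasStrictDerivAt (fun z => z - z₀) 1 z₀ := (hasStrictDerivAt_id z₀).sub_const z₀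
    simpa using HasStrictDerivAt.fun_mul hsub hr.hasStrictDerivAt
  have hψ' := hψ.hasStrictFDerivAt_equiv hr0
  refine ⟨(hψ'.toOpenPartialHomeomorph _).restr {z | φ z = φ z₀ + ((z - z₀) * r z) ^ n},
    ⟨hψ'.mem_toOpenPartialHomeomorph_source, mem_interior_iff_mem_nhds.2 ?_⟩, ?_, ?_⟩
  · filter_upwards [hfac] with z hz
    rw [mul_pow, hrn, ← smul_eq_mul, ← hz, add_sub_cancel]
  · simp
  · exact fun z hz => interior_subset (s := {z | φ z = φ z₀ + ((z - z₀) * r z) ^ n}) hz.2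

theorem two_le_analyticOrderNatAt_sub_of_deriv_eq_zero {φ : ℂ → ℂ} {z₀ : ℂ}
    (hφ : AnalyticAt ℂ φ z₀) (hφ' : deriv φ z₀ = 0)
    (hord : analyticOrderAt (φ · - φ z₀) z₀ ≠ ⊤) :
    2 ≤ analyticOrderNatAt (φ · - φ z₀) z₀ := by
  have hone : 1 ≤ analyticOrderAt (deriv φ) z₀ :=
    Order.one_le_iff_ne_zero.2 (hφ.deriv.analyticOrderAt_ne_zero.2 hφ')
  rw [← Nat.cast_le (α := ℕ∞), Nat.cast_analyticOrderNatAt hord, ← hφ.analyticOrderAt_deriv_add_one]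
  exact add_le_add_left hone 1

theorem exists_openPartialHomeomorph_re_eq_of_deriv_eq_zero {φ : ℂ → ℂ} {z₀ : ℂ}
    (hφ : AnalyticAt ℂ φ z₀) (hφ' : deriv φ z₀ = 0) :
    ∃ (e : OpenPartialHomeomorph ℂ ℂ) (n : ℕ), 2 ≤ n ∧ z₀ ∈ e.source ∧ e z₀ = 0 ∧
      ∀ z ∈ e.source, (e z ^ n).re = 0 → (φ z).re = (φ z₀).re := by
  by_cases hord : analyticOrderAt (φ · - φ z₀) z₀ = ⊤
  · refine ⟨(Homeomorph.subRight z₀).toOpenPartialHomeomorph.restr {z | φ z - φ z₀ = 0}, 2, le_rfl,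
      ⟨mem_univ _, mem_interior_iff_mem_nhds.2 (analyticOrderAt_eq_top.1 hord)⟩, sub_self z₀,
      fun z hz _ => ?_⟩
    rw [sub_eq_zero.1 (interior_subset (s := {z | φ z - φ z₀ = 0}) hz.2)]
  · obtain ⟨e, hz₀, he0, he⟩ := exists_openPartialHomeomorph_eq_add_pow hφ hord
    refine ⟨e, _, two_le_analyticOrderNatAt_sub_of_deriv_eq_zero hφ hφ' hord, hz₀, he0,
      fun z hz hre => ?_⟩
    rw [he z hz, add_re, hre, add_zero]

theorem exists_three_norm_eq_one_re_pow_eq_zero {n : ℕ} (hn : 2 ≤ n) :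
    ∃ ζ : Fin 3 → ℂ, Function.Injective ζ ∧ ∀ j, ‖ζ j‖ = 1 ∧ (ζ j ^ n).re = 0 := by
  have hξ : IsPrimitiveRoot (exp (2 * Real.pi * I / (2 * n : ℕ))) (2 * n) :=
    isPrimitiveRoot_exp _ (by omega)
  set ξ := exp (2 * Real.pi * I / (2 * n : ℕ))
  obtain ⟨η, hη⟩ := IsAlgClosed.exists_pow_nat_eq I (by omega : 0 < n)
  have hη1 : ‖η‖ = 1 := by
    refine (pow_eq_one_iff_of_nonneg (norm_nonneg η) (by omega : n ≠ 0)).1 ?_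
    rw [← norm_pow, hη, norm_I]
  have hη0 : η ≠ 0 := norm_ne_zero_iff.1 (hη1.trans_ne one_ne_zero)
  refine ⟨fun j => η * ξ ^ (j : ℕ), fun i j hij => ?_, fun j => ⟨?_, ?_⟩⟩
  · exact Fin.ext (hξ.pow_inj (by omega) (by omega) (mul_left_cancel₀ hη0 hij))
  · rw [norm_mul, norm_pow, hη1, hξ.norm'_eq_one (by omega), one_pow, one_mul]
  · have hsq : ((ξ ^ (j : ℕ)) ^ n) ^ 2 = 1 := by
      rw [← pow_mul, ← pow_mul, show (j : ℕ) * (n * 2) = 2 * n * j by ring, pow_mul,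
        hξ.pow_eq_one, one_pow]
    rw [mul_pow, hη]
    rcases sq_eq_one_iff.1 hsq with h | h <;> simp [h]

theorem exists_ne_eq_of_continuousOn_of_two_lt_card {ι : Type*} [Fintype ι]
    (hι : 2 < Fintype.card ι) {a b v₀ : ℝ} (hab : a ≤ b) {c : ι → ℝ → ℝ}
    (hc : ∀ i, ContinuousOn (c i) (Icc a b)) (ha : ∀ i, c i a = v₀) (hb : ∀ i, c i b ≠ v₀) :
    ∃ i j, i ≠ j ∧ ∃ s ∈ Ioc a b, ∃ t ∈ Ioc a b, c i s = c j t := by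
  have hivt : ∀ i j, c i b ∈ uIcc v₀ (c j b) → ∃ s ∈ Ioc a b, ∃ t ∈ Ioc a b, c i s = c j t := by
    intro i j hij
    rw [← ha j] at hij
    obtain ⟨t, ht, hct⟩ := intermediate_value_uIcc (by simpa [hab] using hc j) hij
    rw [uIcc_of_le hab] at ht
    have hta : t ≠ a := fun h => hb i (by rw [← hct, h, ha])
    have hat : a < t := lt_of_le_of_ne ht.1 hta.symm
    exact ⟨b, ⟨hat.trans_le ht.2, le_rfl⟩, t, ⟨hat, ht.2⟩, hct.symm⟩
  obtain ⟨i, j, hij, hside⟩ := Fintype.exists_ne_map_eq_of_card_lt (fun i => decide (v₀ < c i b))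
    (by simpa using hι)
  have hside' : c i b ∈ uIcc v₀ (c j b) ∨ c j b ∈ uIcc v₀ (c i b) := by
    simp only [decide_eq_decide] at hside
    grind [mem_uIcc]
  rcases hside' with h | h
  · exact ⟨i, j, hij, hivt i j h⟩
  · exact ⟨j, i, hij.symm, hivt j i h⟩

theorem exists_norm_eq_one_mul_add_conj_mul_eq_zero {α β : ℂ} (hαβ : ‖α‖ = ‖β‖) :
    ∃ l : ℂ, ‖l‖ = 1 ∧ l * α + conj l * β = 0 := by
  rcases eq_or_ne α 0 with rfl | hα
  · exact ⟨1, norm_one, by simpa using hαβ.symm⟩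
  obtain ⟨l, hl⟩ := IsAlgClosed.exists_pow_nat_eq (-(β / α)) two_pos
  have hl1 : ‖l‖ = 1 := by
    refine (pow_eq_one_iff_of_nonneg (norm_nonneg l) two_ne_zero).1 ?_
    rw [← norm_pow, hl, norm_neg, norm_div, ← hαβ, div_self (norm_ne_zero_iff.2 hα)]
  have hll : conj l * l = 1 := by rw [conj_mul', hl1, ofReal_one, one_pow]
  have hβ : β = -l ^ 2 * α := by
    rw [hl]
    field_simp
  exact ⟨l, hl1, by linear_combination (-l * α) * hll + conj l * hβ⟩

theorem not_injOn_of_re_eq_on_three_arms {F : ℂ → ℂ} {ε x₀ : ℝ} (hε : 0 < ε)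
    (hF : ContinuousOn F (closedBall 0 ε)) {ζ : Fin 3 → ℂ} (hζ : Function.Injective ζ)
    (hζ1 : ∀ j, ‖ζ j‖ = 1) (hre : ∀ j, ∀ t ∈ Icc 0 ε, (F (t * ζ j)).re = x₀) :
    ¬InjOn F (closedBall 0 ε) := by
  intro hinj
  have harm : ∀ j, ∀ t ∈ Icc 0 ε, (t : ℂ) * ζ j ∈ closedBall (0 : ℂ) ε := fun j t ht => by
    simpa [hζ1 j, abs_of_nonneg ht.1] using ht.2
  have him : ∀ i j, ∀ s ∈ Icc 0 ε, ∀ t ∈ Icc 0 ε, (F (s * ζ i)).im = (F (t * ζ j)).im →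
      (s : ℂ) * ζ i = t * ζ j := fun i j s hs t ht hst =>
    hinj (harm i s hs) (harm j t ht) (Complex.ext ((hre i s hs).trans (hre j t ht).symm) hst)
  have hζ0 : ∀ j, ζ j ≠ 0 := fun j => norm_ne_zero_iff.1 ((hζ1 j).trans_ne one_ne_zero)
  have hend : ∀ j, (F (ε * ζ j)).im ≠ (F 0).im := fun j hj => by
    have := him j j ε (right_mem_Icc.2 hε.le) 0 (left_mem_Icc.2 hε.le) (by simpa using hj)
    simp [hζ0 j, hε.ne'] at this
  obtain ⟨i, j, hij, s, hs, t, ht, hst⟩ := exists_ne_eq_of_continuousOn_of_two_lt_card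
    (c := fun j t => (F (t * ζ j)).im) (by simp) hε.le
    (fun j => continuous_im.comp_continuousOn (hF.comp (by fun_prop) (harm j)))
    (fun j => by simp) hend
  have heq := him i j s (Ioc_subset_Icc_self hs) t (Ioc_subset_Icc_self ht) hst
  have hst' : s = t := by
    simpa [hζ1, abs_of_pos hs.1, abs_of_pos ht.1] using congrArg norm heq
  rw [hst'] at heq
  exact hij (hζ (mul_left_cancel₀ (ofReal_ne_zero.2 ht.1.ne') heq))

/-- **Lewy's theorem**. At a zero of the Jacobian some `Re (l (h + conj g))`, `|l| = 1`, is the real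
part of an analytic function with a critical point, so it is constant on three arms issuing from
that point; on these, `Im (l (h + conj g))` would embed a triod in the real line. -/
theorem jacobian_ne_zero_of_injOn {U : Set ℂ} (hU : IsOpen U) (hh : DifferentiableOn ℂ h U)
    (hg : DifferentiableOn ℂ g U) (hinj : InjOn (fun z => h z + conj (g z)) U) (hz : z ∈ U) :
    jacobian h g z ≠ 0 := by
  intro hJ
  have hUz := hU.mem_nhds hz
  have hnorm : ‖deriv h z‖ = ‖deriv g z‖ :=
    (sq_eq_sq₀ (norm_nonneg _) (norm_nonneg _)).1 (sub_eq_zero.1 hJ)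
  obtain ⟨l, hl, hl0⟩ := exists_norm_eq_one_mul_add_conj_mul_eq_zero hnorm
  have hφ : AnalyticAt ℂ (fun z => l * h z + conj l * g z) z :=
    (analyticAt_const.fun_mul (hh.analyticAt hUz)).fun_add
      (analyticAt_const.fun_mul (hg.analyticAt hUz))
  have hφ' : deriv (fun z => l * h z + conj l * g z) z = 0 :=
    (((hh.differentiableAt hUz).hasDerivAt.const_mul l).fun_add
      ((hg.differentiableAt hUz).hasDerivAt.const_mul _)).deriv.trans hl0
  obtain ⟨e, n, hn, hze, he0, he⟩ := exists_openPartialHomeomorph_re_eq_of_deriv_eq_zero hφ hφ'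
  obtain ⟨ζ, hζ, hζ'⟩ := exists_three_norm_eq_one_re_pow_eq_zero hn
  have hUe : ∀ᶠ y in 𝓝 0, y ∈ e.target ∩ e.symm ⁻¹' U := by
    rw [← he0]
    exact (e.isOpen_inter_preimage_symm hU).mem_nhds
      ⟨e.map_source hze, by rwa [mem_preimage, e.left_inv hze]⟩
  obtain ⟨ε, hε, hεU⟩ := nhds_basis_closedBall.mem_iff.1 hUe
  have hsymm := e.continuousOn_symm.mono (hεU.trans inter_subset_left)
  have hmaps : MapsTo e.symm (closedBall 0 ε) U := hεU.trans inter_subset_right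
  let F : ℂ → ℂ := fun y => l * (h (e.symm y) + conj (g (e.symm y)))
  have hF : ContinuousOn F (closedBall 0 ε) :=
    continuousOn_const.mul ((hh.continuousOn.comp hsymm hmaps).add
      (continuous_conj.comp_continuousOn (hg.continuousOn.comp hsymm hmaps)))
  refine not_injOn_of_re_eq_on_three_arms (x₀ := (l * h z + conj l * g z).re) hε hF hζ
    (fun j => (hζ' j).1) (fun j t ht => ?_) fun x hx y hy hxy => ?_
  · have hy : (t : ℂ) * ζ j ∈ e.target :=
      (hεU (by simpa [(hζ' j).1, abs_of_nonneg ht.1] using ht.2)).1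
    have hy' : ((e (e.symm (t * ζ j))) ^ n).re = 0 := by
      rw [e.right_inv hy, mul_pow, ← ofReal_pow, re_ofReal_mul, (hζ' j).2, mul_zero]
    rw [← he _ (e.map_target hy) hy']
    simp only [F, mul_re, add_re, add_im, conj_re, conj_im]
    ring
  · exact e.symm.injOn (hεU hx).1 (hεU hy).1 <| hinj (hmaps hx) (hmaps hy) <|
      mul_left_cancel₀ (norm_ne_zero_iff.1 (hl.trans_ne one_ne_zero)) hxy

/-! ### Harmonic mappings with convex image -/

theorem re_mul_conj_add_pos {A B a : ℂ} (hBA : ‖B‖ < ‖A‖) (ha : ‖a‖ < 1) :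
    0 < ((A + a * B) * conj (A + conj B + a * conj (A + conj B))).re := by
  have hid : 2 * ((A + a * B) * conj (A + conj B + a * conj (A + conj B))).re =
      ‖A + conj B + a * conj (A + conj B)‖ ^ 2 + (1 - ‖a‖ ^ 2) * (‖A‖ ^ 2 - ‖B‖ ^ 2) := by
    simp only [← normSq_eq_norm_sq, normSq_apply, add_re, add_im, mul_re, mul_im, conj_re, conj_im]
    ring
  have ha2 : 0 < 1 - ‖a‖ ^ 2 := sub_pos.2 (pow_lt_one₀ (norm_nonneg a) ha two_ne_zero)
  have hAB : 0 < ‖A‖ ^ 2 - ‖B‖ ^ 2 := sub_pos.2 (pow_lt_pow_left₀ hBA (norm_nonneg B) two_ne_zero)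
  linarith [mul_pos ha2 hAB, sq_nonneg ‖A + conj B + a * conj (A + conj B)‖]

theorem exists_curve_hasDerivAt_of_convex_image {E F : Type*} [NormedAddCommGroup E]
    [NormedSpace ℝ E] [CompleteSpace E] [NormedAddCommGroup F] [NormedSpace ℝ F] {f : E → F}
    {f' : E → E →L[ℝ] F} {U : Set E} (hU : IsOpen U) (hinj : InjOn f U) (hconv : Convex ℝ (f '' U))
    (hf : ∀ x ∈ U, HasStrictFDerivAt f (f' x) x) (hf' : ∀ x ∈ U, (f' x).IsInvertible) {x y : E}
    (hx : x ∈ U) (hy : y ∈ U) :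
    ∃ γ : ℝ → E, γ 0 = x ∧ γ 1 = y ∧
      ∀ t ∈ Icc (0 : ℝ) 1, γ t ∈ U ∧ ∃ d, HasDerivAt γ d t ∧ f' (γ t) d = f y - f x := by
  have : Nonempty E := ⟨x⟩
  have hleft : ∀ z ∈ U, Function.invFunOn f U (f z) = z := fun z hz => hinj.leftInvOn_invFunOn hz
  refine ⟨fun t => Function.invFunOn f U (AffineMap.lineMap (f x) (f y) t), by simp [hleft x hx],
    by simp [hleft y hy], fun t ht => ?_⟩
  obtain ⟨z, hz, hzt⟩ := hconv.lineMap_mem (mem_image_of_mem f hx) (mem_image_of_mem f hy) ht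
  obtain ⟨L, hL⟩ := hf' z hz
  have hinv : HasStrictFDerivAt (Function.invFunOn f U) (L.symm : F →L[ℝ] E) (f z) :=
    (hL ▸ hf z hz).to_local_left_inverse ((hU.eventually_mem hz).mono hleft)
  beta_reduce
  rw [← hzt, hleft z hz]
  refine ⟨hz, L.symm (f y - f x), ?_, ?_⟩
  · rw [hzt] at hinv
    exact hinv.hasFDerivAt.comp_hasDerivAt t AffineMap.hasDerivAt_lineMap
  · rw [← hL, ContinuousLinearEquiv.coe_coe, ContinuousLinearEquiv.apply_symm_apply]

/-- One half of the Clunie–Sheil-Small shear theorem. Along the preimage of a segment of direction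
`c = h' γ' + conj (g' γ')` the derivative of `h + a g` has positive real part against the fixed
number `c + a conj c`. -/
theorem injOn_add_mul_of_convex_image {U : Set ℂ} (hU : IsOpen U) (hh : DifferentiableOn ℂ h U)
    (hg : DifferentiableOn ℂ g U) (hinj : InjOn (fun z => h z + conj (g z)) U)
    (hconv : Convex ℝ ((fun z => h z + conj (g z)) '' U)) (hJ : ∀ z ∈ U, 0 < jacobian h g z) {a : ℂ}
    (ha : ‖a‖ < 1) : InjOn (fun z => h z + a * g z) U := by
  intro x hx y hy hxy
  by_contra hne
  have hinv : ∀ z ∈ U, (wirtingerCLM (deriv h z) (conj (deriv g z))).IsInvertible := fun z hz =>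
    ⟨_, ContinuousLinearMap.coe_toContinuousLinearEquivOfDetNeZero _
      ((det_wirtingerCLM_deriv_eq_jacobian h g z).trans_ne (hJ z hz).ne')⟩
  obtain ⟨γ, hγ0, hγ1, hγ⟩ := exists_curve_hasDerivAt_of_convex_image hU hinj hconv
    (fun z hz => hasStrictFDerivAt_add_conj (hh.analyticAt (hU.mem_nhds hz))
      (hg.analyticAt (hU.mem_nhds hz))) hinv hx hy
  set c := h y + conj (g y) - (h x + conj (g x))
  have hc0 : c ≠ 0 := sub_ne_zero.2 fun h => hne (hinj hy hx h).symm
  let ψ : ℝ → ℝ := fun t => ((h (γ t) + a * g (γ t)) * conj (c + a * conj c)).re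
  have hψ : ∀ t ∈ Icc (0 : ℝ) 1, ∃ ψ', HasDerivAt ψ ψ' t ∧ 0 < ψ' := by
    intro t ht
    obtain ⟨hU', d, hd, hdc⟩ := hγ t ht
    rw [wirtingerCLM_apply, ← map_mul] at hdc
    have hd0 : d ≠ 0 := by
      rintro rfl
      exact hc0 (by simpa using hdc.symm)
    have hh' := (hh.differentiableAt (hU.mem_nhds hU')).hasDerivAt.scomp t hd
    have hg' := (hg.differentiableAt (hU.mem_nhds hU')).hasDerivAt.scomp t hd
    refine ⟨_, reCLM.hasFDerivAt.comp_hasDerivAt t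
      ((hh'.add (hg'.const_mul a)).mul_const (conj (c + a * conj c))), ?_⟩
    have hlt : ‖deriv g (γ t) * d‖ < ‖deriv h (γ t) * d‖ := by
      rw [norm_mul, norm_mul]
      exact mul_lt_mul_of_pos_right
        (lt_of_pow_lt_pow_left₀ 2 (norm_nonneg _) (sub_pos.1 (hJ _ hU'))) (norm_pos_iff.2 hd0)
    simpa [← hdc, smul_eq_mul, mul_comm d] using re_mul_conj_add_pos hlt ha
  have hmono : StrictMonoOn ψ (Icc 0 1) := by
    refine strictMonoOn_of_deriv_pos (convex_Icc 0 1) (fun t ht => ?_) fun t ht => ?_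
    · exact (hψ t ht).choose_spec.1.continuousAt.continuousWithinAt
    · obtain ⟨ψ', hψ', hpos⟩ := hψ t (interior_subset ht)
      exact hψ'.deriv ▸ hpos
  have hlt := hmono (by simp) (by simp) (zero_lt_one' ℝ)
  simp only [ψ, hγ0, hγ1] at hlt
  exact hlt.ne (by rw [show h x + a * g x = h y + a * g y from hxy])

/-! ### The area theorem -/

theorem integral_neg_pi_pi_circleMap_eq {E : Type*} [NormedAddCommGroup E] [NormedSpace ℝ E]
    (u : ℂ → E) (c : ℂ) (R : ℝ) :
    ∫ θ in -Real.pi..Real.pi, u (circleMap c R θ) =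
      (2 * Real.pi) • Real.circleAverage u c R := by
  have hper : Function.Periodic (fun θ => u (circleMap c R θ)) (2 * Real.pi) := fun θ => by
    simp only [periodic_circleMap c R θ]
  have hshift := hper.intervalIntegral_add_eq (-Real.pi) 0
  rw [show -Real.pi + 2 * Real.pi = Real.pi by ring, zero_add] at hshift
  rw [hshift, Real.circleAverage_def, smul_inv_smul₀ Real.two_pi_pos.ne']

theorem setIntegral_closedBall_diff_ball_eq {E : Type*} [NormedAddCommGroup E] [NormedSpace ℝ E]
    {u : ℂ → E} {r ρ : ℝ} (hr : 0 < r) (hrρ : r ≤ ρ)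
    (hu : ContinuousOn u (closedBall 0 ρ \ ball 0 r)) :
    ∫ z in closedBall 0 ρ \ ball 0 r, u z =
      ∫ t in r..ρ, (2 * Real.pi * t) • Real.circleAverage u 0 t := by
  have hcont : ContinuousOn (fun p : ℝ × ℝ => p.1 • u (circleMap 0 p.1 p.2))
      (Icc r ρ ×ˢ Icc (-Real.pi) Real.pi) := by
    refine continuousOn_fst.smul (hu.comp (by fun_prop) fun p hp => ?_)
    simpa [abs_of_pos (hr.trans_le hp.1.1), and_comm] using hp.1
  have hpolar : ∀ p ∈ polarCoord.target,
      p.1 • (closedBall 0 ρ \ ball 0 r).indicator u (Complex.polarCoord.symm p) =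
        (Icc r ρ ×ˢ univ).indicator (fun p => p.1 • u (circleMap 0 p.1 p.2)) p := fun p hp => by
    have hsymm : Complex.polarCoord.symm p = circleMap 0 p.1 p.2 := by
      simp [Complex.polarCoord_symm_apply, circleMap_zero, exp_mul_I]
    have hmem : circleMap 0 p.1 p.2 ∈ closedBall (0 : ℂ) ρ \ ball 0 r ↔ p ∈ Icc r ρ ×ˢ univ := by
      simp [abs_of_pos (show 0 < p.1 from hp.1), and_comm]
    rw [hsymm]
    by_cases h : p ∈ Icc r ρ ×ˢ univ
    · rw [indicator_of_mem h, indicator_of_mem (hmem.2 h)]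
    · rw [indicator_of_notMem h, indicator_of_notMem (mt hmem.1 h), smul_zero]
  have hset : polarCoord.target ∩ Icc r ρ ×ˢ univ = Icc r ρ ×ˢ Ioo (-Real.pi) Real.pi := by
    rw [polarCoord_target, prod_inter_prod, inter_univ,
      inter_eq_right.2 fun (t : ℝ) (ht : t ∈ Icc r ρ) => mem_Ioi.2 (hr.trans_le ht.1)]
  rw [← integral_indicator (measurableSet_closedBall.diff measurableSet_ball),
    ← Complex.integral_comp_polarCoord_symm,
    setIntegral_congr_fun polarCoord.open_target.measurableSet hpolar,
    setIntegral_indicator (measurableSet_Icc.prod .univ), hset, Measure.volume_eq_prod,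
    setIntegral_prod _ ((hcont.integrableOn_compact (isCompact_Icc.prod isCompact_Icc)).mono_set
      (prod_mono_right Ioo_subset_Icc_self)), intervalIntegral.integral_of_le hrρ,
    integral_Icc_eq_integral_Ioc]
  refine integral_congr_ae (Eventually.of_forall fun t => ?_)
  beta_reduce
  rw [integral_smul, ← integral_Ioc_eq_integral_Ioo,
    ← intervalIntegral.integral_of_le (neg_le_self Real.pi_pos.le),
    integral_neg_pi_pi_circleMap_eq, smul_smul, mul_comm t]

theorem re_le_circleAverage {A : ℂ → ℂ} {u : ℂ → ℝ} {c : ℂ} {R : ℝ}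
    (hA : DifferentiableOn ℂ A (closedBall c |R|)) (hu : CircleIntegrable u c R)
    (hle : ∀ z ∈ sphere c |R|, (A z).re ≤ u z) : (A c).re ≤ Real.circleAverage u c R := by
  have hAint : CircleIntegrable A c R :=
    (hA.continuousOn.mono sphere_subset_closedBall).circleIntegrable'
  have hmean := (hA.diffContOnCl_ball le_rfl).circleAverage
  calc (A c).re = Real.circleAverage (fun z => (A z).re) c R := by
        rw [← hmean]
        exact (reCLM.circleAverage_comp_comm hAint).symm
    _ ≤ _ := Real.circleAverage_mono
      ((continuous_re.comp_continuousOn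
        (hA.continuousOn.mono sphere_subset_closedBall)).circleIntegrable') hu hle

theorem re_norm_sq_add_norm_sq_add_le (w q b : ℂ) :
    (‖w‖ ^ 2 + ‖b‖ ^ 2 + 2 * conj w * q + 2 * conj b * (q - b) : ℂ).re ≤ ‖w + q‖ ^ 2 := by
  have hid : ‖w + q‖ ^ 2 = (‖w‖ ^ 2 + ‖b‖ ^ 2 + 2 * conj w * q + 2 * conj b * (q - b) : ℂ).re +
      ‖q - b‖ ^ 2 := by
    simp only [← ofReal_pow, ← normSq_eq_norm_sq, normSq_apply, add_re, sub_re, mul_re, mul_im,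
      conj_re, conj_im, add_im, sub_im, ofReal_re, re_ofNat, im_ofNat]
    ring
  linarith [sq_nonneg ‖q - b‖]

theorem inv_pow_four_add_norm_sq_le_circleAverage {q : ℂ → ℂ} {t : ℝ} (ht : 0 < t)
    (hq : DifferentiableOn ℂ q (closedBall 0 t)) :
    (t ^ 4)⁻¹ + ‖q 0‖ ^ 2 ≤ Real.circleAverage (fun z => ‖-(z ^ 2)⁻¹ + q z‖ ^ 2) 0 t := by
  -- On `|z| = t` one has `conj (-z⁻²) = -t⁻⁴ z²`, which makes the lower bound the real part of an
  -- analytic function.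
  let A : ℂ → ℂ := fun z => (t ^ 4 : ℂ)⁻¹ + ‖q 0‖ ^ 2 + 2 * (-(t ^ 4 : ℂ)⁻¹ * z ^ 2) * q z +
    2 * conj (q 0) * (q z - q 0)
  rw [← abs_of_pos ht] at hq
  have hA : DifferentiableOn ℂ A (closedBall 0 |t|) := by fun_prop
  have hA0 : (A 0).re = (t ^ 4)⁻¹ + ‖q 0‖ ^ 2 := by
    simp [A, ← ofReal_pow, ← ofReal_inv, -map_pow, -map_inv₀]
  have hnorm : ∀ z ∈ sphere (0 : ℂ) |t|, ‖z‖ = t := fun z hz => by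
    simpa [abs_of_pos ht] using hz
  have hu : ContinuousOn (fun z => ‖-(z ^ 2)⁻¹ + q z‖ ^ 2) (sphere 0 |t|) :=
    (((continuousOn_id.pow 2).inv₀ fun z hz => pow_ne_zero 2
      (ne_of_mem_sphere hz (abs_pos.2 ht.ne').ne')).neg.add
        (hq.continuousOn.mono sphere_subset_closedBall)).norm.pow 2
  rw [← hA0]
  refine re_le_circleAverage hA hu.circleIntegrable' fun z hz => ?_
  have hz0 : z ≠ 0 := norm_pos_iff.1 ((hnorm z hz).symm ▸ ht)
  have hw : (‖-(z ^ 2)⁻¹‖ : ℂ) ^ 2 = (t ^ 4 : ℂ)⁻¹ := by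
    rw [norm_neg, norm_inv, norm_pow, hnorm z hz]
    push_cast
    ring
  have hconj : conj (-(z ^ 2)⁻¹) = -(t ^ 4 : ℂ)⁻¹ * z ^ 2 := by
    have hzz : (t : ℂ) ^ 4 = (z * conj z) ^ 2 := by
      rw [mul_conj', hnorm z hz]
      ring
    rw [hzz, map_neg, map_inv₀, map_pow]
    field_simp
  have hle := re_norm_sq_add_norm_sq_add_le (-(z ^ 2)⁻¹) (q z) (q 0)
  rwa [hw, hconj] at hle

theorem integral_two_pi_mul_inv_pow_four_add {r ρ : ℝ} (hr : 0 < r) (hrρ : r ≤ ρ) (B : ℝ) :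
    ∫ t in r..ρ, 2 * Real.pi * t * ((t ^ 4)⁻¹ + B) =
      Real.pi * (1 / r ^ 2 - 1 / ρ ^ 2 + B * (ρ ^ 2 - r ^ 2)) := by
  have hne : ∀ t ∈ uIcc r ρ, t ≠ 0 := fun t ht => (hr.trans_le (uIcc_of_le hrρ ▸ ht).1).ne'
  have hprim : ∀ t ∈ uIcc r ρ, HasDerivAt (fun t => Real.pi * (B * t ^ 2 - (t ^ 2)⁻¹))
      (2 * Real.pi * t * ((t ^ 4)⁻¹ + B)) t := fun t ht => by
    have ht0 := hne t ht
    refine ((((hasDerivAt_pow 2 t).const_mul B).fun_sub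
      ((hasDerivAt_pow 2 t).fun_inv (pow_ne_zero 2 ht0))).const_mul Real.pi).congr_deriv ?_
    field_simp
    ring
  have hcont : ContinuousOn (fun t => 2 * Real.pi * t * ((t ^ 4)⁻¹ + B)) (uIcc r ρ) := by
    have : ∀ t ∈ uIcc r ρ, t ^ 4 ≠ 0 := fun t ht => pow_ne_zero 4 (hne t ht)
    fun_prop (disch := assumption)
  rw [intervalIntegral.integral_eq_sub_of_hasDerivAt hprim hcont.intervalIntegrable]
  ring

theorem le_setIntegral_norm_neg_inv_sq_add_sq {q : ℂ → ℂ} {r ρ : ℝ} (hr : 0 < r) (hrρ : r ≤ ρ)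
    (hq : DifferentiableOn ℂ q (closedBall 0 ρ)) :
    Real.pi * (1 / r ^ 2 - 1 / ρ ^ 2 + ‖q 0‖ ^ 2 * (ρ ^ 2 - r ^ 2)) ≤
      ∫ z in closedBall 0 ρ \ ball 0 r, ‖-(z ^ 2)⁻¹ + q z‖ ^ 2 := by
  have hu : ContinuousOn (fun z => ‖-(z ^ 2)⁻¹ + q z‖ ^ 2) (closedBall 0 ρ \ ball 0 r) := by
    have hne : ∀ z ∈ closedBall (0 : ℂ) ρ \ ball 0 r, z ^ 2 ≠ 0 := fun z hz =>
      pow_ne_zero 2 fun h => hz.2 (by simp [h, hr])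
    exact (((continuousOn_id.pow 2).inv₀ hne).neg.add
      (hq.continuousOn.mono sdiff_subset)).norm.pow 2
  have hpos : ∀ t ∈ Icc r ρ, 0 < t := fun t ht => hr.trans_le ht.1
  rw [setIntegral_closedBall_diff_ball_eq hr hrρ hu, ← integral_two_pi_mul_inv_pow_four_add hr hrρ]
  refine intervalIntegral.integral_mono_on hrρ ?_ ?_ fun t ht => ?_
  · refine ContinuousOn.intervalIntegrable fun t ht => ?_
    have := (hpos t (uIcc_of_le hrρ ▸ ht)).ne'
    fun_prop (disch := positivity)
  · refine ContinuousOn.intervalIntegrable_of_Icc hrρ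
      ((continuousOn_const.mul continuousOn_id).smul
        (Real.ContinuousOn.circleAverage (hu.mono fun z hz => ?_) fun t ht => (hpos t ht).le))
    simpa [and_comm] using hz
  · rw [smul_eq_mul]
    have := hpos t ht
    gcongr
    exact inv_pow_four_add_norm_sq_le_circleAverage this
      (hq.mono (closedBall_subset_closedBall ht.2))

theorem inv_add_mul_sub_add_mul_sq_le {r t B C : ℝ} (hr : 0 < r) (hrt : r ≤ t) (ht : t ≤ 1)
    (hB : 0 ≤ B) (hC : 0 ≤ C) (hsmall : 2 * (r * (B + C)) ≤ 1) :
    t⁻¹ + B * (t - r ^ 2 / t) + C * t ^ 2 ≤ r⁻¹ + C * r ^ 2 := by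
  have ht0 : 0 < t := hr.trans_le hrt
  have hfac : r⁻¹ + C * r ^ 2 - (t⁻¹ + B * (t - r ^ 2 / t) + C * t ^ 2) =
      (t - r) * (1 - r * (B + C * t) * (t + r)) / (r * t) := by
    field_simp
    ring
  have hCt : B + C * t ≤ B + C := by linarith [mul_le_of_le_one_right hC ht]
  have hle : r * (B + C * t) * (t + r) ≤ 1 := calc
    r * (B + C * t) * (t + r) ≤ r * (B + C) * (1 + 1) := by gcongr; exact hrt.trans ht
    _ ≤ 1 := by linarith
  refine sub_nonneg.1 (hfac ▸ ?_)
  exact div_nonneg (mul_nonneg (sub_nonneg.2 hrt) (sub_nonneg.2 hle)) (by positivity)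

theorem exists_norm_sub_deriv_mul_le {p : ℂ → ℂ} {s : Set ℂ} (hs : s ∈ 𝓝 0)
    (hp : DifferentiableOn ℂ p s) (hp0 : p 0 = 0) {K : Set ℂ} (hK : IsCompact K) (hKs : K ⊆ s) :
    ∃ C, 0 ≤ C ∧ ∀ z ∈ K, ‖p z - deriv p 0 * z‖ ≤ C * ‖z‖ ^ 2 := by
  have hd : DifferentiableOn ℂ (dslope (dslope p 0) 0) s :=
    (differentiableOn_dslope hs).2 ((differentiableOn_dslope hs).2 hp)
  obtain ⟨C, hC⟩ := hK.exists_bound_of_continuousOn (hd.continuousOn.mono hKs)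
  refine ⟨max C 0, le_max_right _ _, fun z hz => ?_⟩
  have h1 : z * dslope p 0 z = p z := by simpa [hp0] using sub_smul_dslope p 0 z
  have h2 : z * dslope (dslope p 0) 0 z = dslope p 0 z - deriv p 0 := by
    simpa using sub_smul_dslope (dslope p 0) 0 z
  have h3 : p z - deriv p 0 * z = dslope (dslope p 0) 0 z * z ^ 2 := by
    linear_combination -h1 - z * h2
  rw [h3, norm_mul, norm_pow]
  gcongr
  exact (hC z hz).trans (le_max_left _ _)

/-- On `|z| = r` the principal terms `z⁻¹ + b z` are mapped to `(1 - |b|² r⁴) z⁻¹`: the real-linear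
map turns the ellipse that is nearly the image of the circle into a circle. -/
theorem norm_sub_mul_conj_le {b z P : ℂ} {r C : ℝ} (hr : 0 < r) (hrz : r ≤ ‖z‖) (hz1 : ‖z‖ ≤ 1)
    (hC : 0 ≤ C) (hP : ‖P - b * z‖ ≤ C * ‖z‖ ^ 2) (hsmall : 2 * (r * (‖b‖ + C)) ≤ 1) :
    ‖(z⁻¹ + P) - b * r ^ 2 * conj (z⁻¹ + P)‖ ≤ r⁻¹ + (C + ‖b‖ * (‖b‖ + C)) * r ^ 2 := by
  have hz0 : 0 < ‖z‖ := hr.trans_le hrz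
  have hz : z ≠ 0 := norm_pos_iff.1 hz0
  have hinv : conj z⁻¹ = z / ‖z‖ ^ 2 := by
    rw [← mul_conj', map_inv₀]
    field_simp
  have hdec : (z⁻¹ + P) - b * r ^ 2 * conj (z⁻¹ + P) =
      z⁻¹ + b * (z * ((1 - r ^ 2 / ‖z‖ ^ 2 : ℝ) : ℂ)) + (P - b * z) - b * r ^ 2 * conj P := by
    rw [map_add, hinv]
    push_cast
    ring
  have hfac : 0 ≤ 1 - r ^ 2 / ‖z‖ ^ 2 := by
    rw [sub_nonneg, div_le_one (by positivity)]
    exact pow_le_pow_left₀ hr.le hrz 2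
  have hmid : ‖b * (z * ((1 - r ^ 2 / ‖z‖ ^ 2 : ℝ) : ℂ))‖ = ‖b‖ * (‖z‖ - r ^ 2 / ‖z‖) := by
    rw [norm_mul, norm_mul, Complex.norm_of_nonneg hfac]
    field_simp
  have hPn : ‖P‖ ≤ ‖b‖ + C := calc
    ‖P‖ = ‖b * z + (P - b * z)‖ := by ring_nf
    _ ≤ ‖b‖ * ‖z‖ + C * ‖z‖ ^ 2 := (norm_add_le _ _).trans (add_le_add (norm_mul _ _).le hP)
    _ ≤ ‖b‖ * 1 + C * 1 := by gcongr; exact pow_le_one₀ (norm_nonneg _) hz1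
    _ = ‖b‖ + C := by ring
  have hlast : ‖b * r ^ 2 * conj P‖ ≤ ‖b‖ * (‖b‖ + C) * r ^ 2 := by
    rw [norm_mul, norm_mul, norm_pow, Complex.norm_of_nonneg hr.le, RCLike.norm_conj,
      mul_right_comm]
    gcongr
  calc ‖(z⁻¹ + P) - b * r ^ 2 * conj (z⁻¹ + P)‖
      ≤ ‖z‖⁻¹ + ‖b‖ * (‖z‖ - r ^ 2 / ‖z‖) + C * ‖z‖ ^ 2 + ‖b‖ * (‖b‖ + C) * r ^ 2 := by
        rw [hdec, ← norm_inv, ← hmid]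
        exact (norm_sub_le _ _).trans (add_le_add (norm_add₃_le.trans (by gcongr)) hlast)
    _ ≤ r⁻¹ + C * r ^ 2 + ‖b‖ * (‖b‖ + C) * r ^ 2 := by
        gcongr ?_ + _
        exact inv_add_mul_sub_add_mul_sq_le hr hrz hz1 (norm_nonneg b) hC hsmall
    _ = _ := by ring

theorem jacobian_const_mul_right (k : ℂ → ℂ) (c z : ℂ) :
    jacobian k (fun z => c * k z) z = (1 - ‖c‖ ^ 2) * ‖deriv k z‖ ^ 2 := by
  rw [jacobian, deriv_const_mul_field, norm_mul]
  ring

theorem volume_real_image_sub_mul_conj {k : ℂ → ℂ} {A : Set ℂ} (hA : MeasurableSet A)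
    (hk : AnalyticOnNhd ℂ k A) (hinj : InjOn k A) {c : ℂ} (hc : ‖c‖ < 1) :
    volume.real ((fun z => k z - c * conj (k z)) '' A) =
      (1 - ‖c‖ ^ 2) * ∫ z in A, ‖deriv k z‖ ^ 2 := by
  have hF : (fun z => k z - c * conj (k z)) = fun z => k z + conj (-conj c * k z) := by
    ext z
    simp [sub_eq_add_neg]
  have hF' : (fun z => k z - c * conj (k z)) = wirtingerCLM 1 (-c) ∘ k := by
    ext z
    simp [sub_eq_add_neg]
  have hFinj : InjOn (fun z => k z - c * conj (k z)) A :=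
    hF' ▸ (wirtingerCLM_injective (by simpa using hc.ne')).comp_injOn hinj
  have hpos : 0 ≤ 1 - ‖c‖ ^ 2 := sub_nonneg.2 (pow_le_one₀ (norm_nonneg c) hc.le)
  rw [hF] at hFinj ⊢
  rw [measureReal_image_add_conj hA hk (fun z hz => analyticAt_const.fun_mul (hk z hz)) hFinj,
    ← integral_const_mul]
  congr with z
  rw [jacobian_const_mul_right, norm_neg, RCLike.norm_conj,
    abs_of_nonneg (mul_nonneg hpos (sq_nonneg _))]

theorem volume_real_closedBall {M : ℝ} (hM : 0 ≤ M) (c : ℂ) :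
    volume.real (closedBall c M) = Real.pi * M ^ 2 := by
  simp [Measure.real, Complex.volume_closedBall, ENNReal.toReal_ofReal hM, mul_comm]

theorem mul_setIntegral_norm_neg_inv_sq_add_sq_le {p : ℂ → ℂ} {b : ℂ} {r ρ C : ℝ}
    (hp : DifferentiableOn ℂ p (ball 0 1))
    (hinj : InjOn (fun z => z⁻¹ + p z) (ball 0 1 \ {0})) (hr : 0 < r) (hr1 : r < 1) (hρ : ρ < 1)
    (hC : 0 ≤ C) (hpC : ∀ z ∈ closedBall 0 ρ, ‖p z - b * z‖ ≤ C * ‖z‖ ^ 2)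
    (hsmall : 2 * (r * (‖b‖ + C)) ≤ 1) :
    (1 - (‖b‖ * r ^ 2) ^ 2) *
        ∫ z in closedBall 0 ρ \ ball 0 r, ‖-(z ^ 2)⁻¹ + deriv p z‖ ^ 2 ≤
      Real.pi * (r⁻¹ + (C + ‖b‖ * (‖b‖ + C)) * r ^ 2) ^ 2 := by
  let A : Set ℂ := closedBall 0 ρ \ ball 0 r
  have hA : MeasurableSet A := measurableSet_closedBall.diff measurableSet_ball
  have hAball : A ⊆ ball 0 1 \ {0} := fun z hz =>
    ⟨closedBall_subset_ball hρ hz.1, fun h => hz.2 (by simp [mem_singleton_iff.1 h, hr])⟩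
  have hpz : ∀ z ∈ A, AnalyticAt ℂ p z := fun z hz =>
    hp.analyticAt (isOpen_ball.mem_nhds (hAball hz).1)
  have hk : AnalyticOnNhd ℂ (fun z => z⁻¹ + p z) A := fun z hz =>
    (analyticAt_inv (hAball hz).2).fun_add (hpz z hz)
  have hk' : ∀ z ∈ A, ‖deriv (fun z => z⁻¹ + p z) z‖ ^ 2 = ‖-(z ^ 2)⁻¹ + deriv p z‖ ^ 2 :=
    fun z hz => by
      rw [deriv_fun_add (differentiableAt_inv (hAball hz).2) (hpz z hz).differentiableAt,
        deriv_inv]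
  have hc : ‖b * r ^ 2‖ = ‖b‖ * r ^ 2 := by
    rw [norm_mul, norm_pow, Complex.norm_of_nonneg hr.le]
  have hc1 : ‖b * r ^ 2‖ < 1 := by
    rw [hc]
    nlinarith [norm_nonneg b, mul_nonneg (norm_nonneg b) hr.le, mul_nonneg hr.le hC]
  have himage : (fun z => z⁻¹ + p z - b * r ^ 2 * conj (z⁻¹ + p z)) '' A ⊆
      closedBall 0 (r⁻¹ + (C + ‖b‖ * (‖b‖ + C)) * r ^ 2) := by
    rintro _ ⟨z, hz, rfl⟩
    have hrz : r ≤ ‖z‖ := by simpa using hz.2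
    have hz1 : ‖z‖ ≤ 1 := (mem_closedBall_zero_iff.1 hz.1).trans hρ.le
    exact mem_closedBall_zero_iff.2 (norm_sub_mul_conj_le hr hrz hz1 hC (hpC z hz.1) hsmall)
  have hvol := measureReal_mono himage measure_closedBall_lt_top.ne (μ := volume)
  rwa [volume_real_image_sub_mul_conj hA hk (hinj.mono hAball) hc1, setIntegral_congr_fun hA hk',
    hc, volume_real_closedBall (by positivity)] at hvol

theorem area_inequality {p : ℂ → ℂ} (hp : DifferentiableOn ℂ p (ball 0 1)) {r ρ C : ℝ}
    (hinj : InjOn (fun z => z⁻¹ + p z) (ball 0 1 \ {0})) (hr : 0 < r) (hrρ : r ≤ ρ)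
    (hρ : ρ < 1) (hC : 0 ≤ C)
    (hpC : ∀ z ∈ closedBall 0 ρ, ‖p z - deriv p 0 * z‖ ≤ C * ‖z‖ ^ 2)
    (hsmall : 2 * (r * (‖deriv p 0‖ + C)) ≤ 1) :
    (1 - (‖deriv p 0‖ * r ^ 2) ^ 2) *
        (1 / r ^ 2 - 1 / ρ ^ 2 + ‖deriv p 0‖ ^ 2 * (ρ ^ 2 - r ^ 2)) ≤
      (r⁻¹ + (C + ‖deriv p 0‖ * (‖deriv p 0‖ + C)) * r ^ 2) ^ 2 := by
  have hr1 : r < 1 := hrρ.trans_lt hρ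
  have hcoef : 0 ≤ 1 - (‖deriv p 0‖ * r ^ 2) ^ 2 := by
    have : ‖deriv p 0‖ * r ^ 2 ≤ 1 := by
      nlinarith [norm_nonneg (deriv p 0), mul_nonneg (norm_nonneg (deriv p 0)) hr.le,
        mul_nonneg hr.le hC]
    exact sub_nonneg.2 (pow_le_one₀ (by positivity) this)
  refine le_of_mul_le_mul_left ?_ Real.pi_pos
  rw [mul_left_comm]
  exact (mul_le_mul_of_nonneg_left (le_setIntegral_norm_neg_inv_sq_add_sq hr hrρ
    ((hp.deriv isOpen_ball).mono (closedBall_subset_ball hρ))) hcoef).trans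
      (mul_setIntegral_norm_neg_inv_sq_add_sq_le hp hinj hr hr1 hρ hC hpC hsmall)

theorem nonpos_of_eventually_area_inequality {b D K : ℝ}
    (h : ∀ᶠ r in 𝓝[>] 0, (1 - (b * r ^ 2) ^ 2) * (1 / r ^ 2 + D - b ^ 2 * r ^ 2) ≤
      (r⁻¹ + K * r ^ 2) ^ 2) : D ≤ 0 := by
  let bound : ℝ → ℝ := fun r =>
    2 * K * r + K ^ 2 * r ^ 4 + 2 * b ^ 2 * r ^ 2 + D * b ^ 2 * r ^ 4 - b ^ 4 * r ^ 6
  have hlim : Tendsto bound (𝓝[>] 0) (𝓝 0) := by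
    have hcont : ContinuousAt bound 0 := by fun_prop
    simpa [bound] using hcont.tendsto.mono_left nhdsWithin_le_nhds
  refine ge_of_tendsto hlim ?_
  filter_upwards [h, self_mem_nhdsWithin] with r hr hr0
  have hr0 : r ≠ 0 := (mem_Ioi.1 hr0).ne'
  have hid : bound r - D = (r⁻¹ + K * r ^ 2) ^ 2 -
      (1 - (b * r ^ 2) ^ 2) * (1 / r ^ 2 + D - b ^ 2 * r ^ 2) := by
    field_simp
    ring
  linarith

theorem norm_deriv_mul_sq_le_one_of_injOn_inv_add {p : ℂ → ℂ} (hp : DifferentiableOn ℂ p (ball 0 1))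
    (hp0 : p 0 = 0) (hinj : InjOn (fun z => z⁻¹ + p z) (ball 0 1 \ {0})) {ρ : ℝ} (hρ0 : 0 < ρ)
    (hρ : ρ < 1) : ‖deriv p 0‖ * ρ ^ 2 ≤ 1 := by
  obtain ⟨C, hC, hpC⟩ := exists_norm_sub_deriv_mul_le (ball_mem_nhds 0 one_pos) hp hp0
    (isCompact_closedBall 0 ρ) (closedBall_subset_ball hρ)
  have hsmall : ∀ᶠ r in 𝓝[>] (0 : ℝ), 2 * (r * (‖deriv p 0‖ + C)) < 1 := by
    have hcont : ContinuousAt (fun r => 2 * (r * (‖deriv p 0‖ + C))) 0 := by fun_prop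
    exact (hcont.eventually_lt continuousAt_const (by simp)).filter_mono nhdsWithin_le_nhds
  have hD : (‖deriv p 0‖ * ρ) ^ 2 - 1 / ρ ^ 2 ≤ 0 := by
    refine nonpos_of_eventually_area_inequality (b := ‖deriv p 0‖)
      (K := C + ‖deriv p 0‖ * (‖deriv p 0‖ + C)) ?_
    filter_upwards [hsmall, Ioo_mem_nhdsGT hρ0] with r hr hrρ
    convert area_inequality hp hinj hrρ.1 hrρ.2.le hρ hC hpC hr.le using 2
    ring
  have hsq : (‖deriv p 0‖ * ρ ^ 2) ^ 2 ≤ 1 := by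
    rw [sub_nonpos, le_div_iff₀ (by positivity)] at hD
    linarith
  exact (sq_le_one_iff₀ (by positivity)).1 hsq

theorem norm_deriv_le_one_of_injOn_inv_add {p : ℂ → ℂ} (hp : DifferentiableOn ℂ p (ball 0 1))
    (hinj : InjOn (fun z => z⁻¹ + p z) (ball 0 1 \ {0})) : ‖deriv p 0‖ ≤ 1 := by
  have hinj₀ : InjOn (fun z => z⁻¹ + (p z - p 0)) (ball 0 1 \ {0}) := fun x hx y hy hxy =>
    hinj hx hy (by simpa [← add_sub_assoc] using hxy)
  have hcont : ContinuousAt (fun ρ : ℝ => ‖deriv p 0‖ * ρ ^ 2) 1 := by fun_prop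
  have hlim : Tendsto (fun ρ => ‖deriv p 0‖ * ρ ^ 2) (𝓝[<] (1 : ℝ)) (𝓝 ‖deriv p 0‖) := by
    simpa using hcont.tendsto.mono_left nhdsWithin_le_nhds
  refine le_of_tendsto hlim ?_
  filter_upwards [Ioo_mem_nhdsLT one_pos] with ρ hρ
  simpa using norm_deriv_mul_sq_le_one_of_injOn_inv_add (hp.sub_const (p 0)) (sub_self _)
    hinj₀ hρ.1 hρ.2

/-! ### Schwarzian derivatives of univalent functions -/

theorem classicalSchwarzian_eq_of_deriv_eventuallyEq {F φ : ℂ → ℂ} (hF : deriv F =ᶠ[𝓝 z] φ) :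
    classicalSchwarzian F z = deriv (logDeriv φ) z - 1 / 2 * logDeriv φ z ^ 2 := by
  have hpre : preSchwarzian F =ᶠ[𝓝 z] logDeriv φ :=
    hF.eventually_nhds.mono fun _ hw => (logDeriv_congr_nhds hw).eq_of_nhds
  rw [classicalSchwarzian, hpre.deriv_eq, hpre.eq_of_nhds]

theorem differentiableAt_logDeriv {φ : ℂ → ℂ} (hφ : AnalyticAt ℂ φ z) (hφ0 : φ z ≠ 0) :
    DifferentiableAt ℂ (logDeriv φ) z :=
  (hφ.deriv.fun_div hφ hφ0).differentiableAt

theorem classicalSchwarzian_eq_of_deriv_eventuallyEq_mul {F φ : ℂ → ℂ} (hh : AnalyticAt ℂ h z)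
    (hφ : AnalyticAt ℂ φ z) (hh' : deriv h z ≠ 0) (hφ0 : φ z ≠ 0)
    (hF : deriv F =ᶠ[𝓝 z] fun w => deriv h w * φ w) :
    classicalSchwarzian F z = classicalSchwarzian h z + deriv (logDeriv φ) z -
      preSchwarzian h z * logDeriv φ z - 1 / 2 * logDeriv φ z ^ 2 := by
  have hlog : logDeriv (fun w => deriv h w * φ w) =ᶠ[𝓝 z]
      fun w => preSchwarzian h w + logDeriv φ w := by
    filter_upwards [hh.eventually_analyticAt, hφ.eventually_analyticAt,
      hh.deriv.continuousAt.eventually_ne hh', hφ.continuousAt.eventually_ne hφ0] with w h₁ h₂ h₃ h₄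
    exact logDeriv_mul w h₃ h₄ h₁.deriv.differentiableAt h₂.differentiableAt
  have hsum : deriv (fun w => preSchwarzian h w + logDeriv φ w) z =
      deriv (preSchwarzian h) z + deriv (logDeriv φ) z :=
    deriv_fun_add (differentiableAt_logDeriv hh.deriv hh') (differentiableAt_logDeriv hφ hφ0)
  rw [classicalSchwarzian_eq_of_deriv_eventuallyEq hF, hlog.deriv_eq, hlog.eq_of_nhds, hsum,
    classicalSchwarzian]
  ring

theorem classicalSchwarzian_comp {F m : ℂ → ℂ} (hm : AnalyticAt ℂ m z)
    (hF : AnalyticAt ℂ F (m z)) (hm' : deriv m z ≠ 0) (hF' : deriv F (m z) ≠ 0) :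
    classicalSchwarzian (F ∘ m) z =
      classicalSchwarzian F (m z) * deriv m z ^ 2 + classicalSchwarzian m z := by
  have hchain : deriv (F ∘ m) =ᶠ[𝓝 z] fun w => deriv m w * (deriv F ∘ m) w := by
    filter_upwards [hm.eventually_analyticAt,
      hm.continuousAt.eventually hF.eventually_analyticAt] with w hmw hFw
    rw [deriv_comp w hFw.differentiableAt hmw.differentiableAt, mul_comm, Function.comp_apply]
  have hlog : logDeriv (deriv F ∘ m) =ᶠ[𝓝 z] fun w => (preSchwarzian F ∘ m) w * deriv m w := by
    filter_upwards [hm.eventually_analyticAt,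
      hm.continuousAt.eventually hF.eventually_analyticAt] with w hmw hFw
    exact logDeriv_comp hFw.deriv.differentiableAt hmw.differentiableAt
  have hpre : HasDerivAt (preSchwarzian F ∘ m) (deriv (preSchwarzian F) (m z) * deriv m z) z :=
    (differentiableAt_logDeriv hF.deriv hF').hasDerivAt.comp z hm.differentiableAt.hasDerivAt
  have hm'' : deriv (deriv m) z = preSchwarzian m z * deriv m z := by
    rw [preSchwarzian, div_mul_cancel₀ _ hm']
  rw [classicalSchwarzian_eq_of_deriv_eventuallyEq_mul hm (hF.deriv.comp hm) hm' hF' hchain,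
    hlog.deriv_eq, hlog.eq_of_nhds, (hpre.fun_mul hm.deriv.differentiableAt.hasDerivAt).deriv,
    hm'', classicalSchwarzian, classicalSchwarzian, Function.comp_apply]
  ring

theorem hasDerivAt_mobius (α β γ δ : ℂ) (hz : γ * z + δ ≠ 0) :
    HasDerivAt (fun w => (α * w + β) / (γ * w + δ)) ((α * δ - β * γ) / (γ * z + δ) ^ 2) z := by
  refine ((((hasDerivAt_id' z).const_mul α).add_const β).fun_div
    (((hasDerivAt_id' z).const_mul γ).add_const δ) hz).congr_deriv ?_
  ring

theorem classicalSchwarzian_mobius {α β γ δ : ℂ} (hdet : α * δ - β * γ ≠ 0)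
    (hz : γ * z + δ ≠ 0) :
    classicalSchwarzian (fun w => (α * w + β) / (γ * w + δ)) z = 0 := by
  have hden : ∀ᶠ w in 𝓝 z, γ * w + δ ≠ 0 := ContinuousAt.eventually_ne (by fun_prop) hz
  have hlin : ∀ w, HasDerivAt (fun x => γ * x + δ) γ w := fun w => by
    simpa using ((hasDerivAt_id' w).const_mul γ).add_const δ
  have hderiv : deriv (fun w => (α * w + β) / (γ * w + δ)) =ᶠ[𝓝 z]
      fun w => (α * δ - β * γ) * (γ * w + δ) ^ (-2 : ℤ) := by
    filter_upwards [hden] with w hw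
    rw [(hasDerivAt_mobius α β γ δ hw).deriv, zpow_neg, div_eq_mul_inv]
    norm_cast
  have hlog : logDeriv (fun w => (α * δ - β * γ) * (γ * w + δ) ^ (-2 : ℤ)) =
      fun w => -2 * (γ / (γ * w + δ)) := by
    ext w
    rw [logDeriv_const_mul w _ hdet, logDeriv_fun_zpow (hlin w).differentiableAt, logDeriv_apply,
      (hlin w).deriv]
    norm_num
  have hlog' := ((hasDerivAt_const z γ).fun_div (hlin z) hz).const_mul (-2)
  rw [classicalSchwarzian_eq_of_deriv_eventuallyEq hderiv, hlog, hlog'.deriv]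
  field_simp
  ring

theorem logDeriv_one_add_mul_self_zero {P : ℂ → ℂ} (hP : DifferentiableAt ℂ P 0) :
    logDeriv (fun w => 1 + w * P w) 0 = P 0 := by
  have hderiv := ((hasDerivAt_id' (0 : ℂ)).fun_mul hP.hasDerivAt).const_add 1
  rw [logDeriv_apply, hderiv.deriv]
  simp

theorem deriv_logDeriv_one_add_mul_self_zero {P : ℂ → ℂ} (hP : AnalyticAt ℂ P 0) :
    deriv (logDeriv fun w => 1 + w * P w) 0 = 2 * deriv P 0 - P 0 ^ 2 := by
  have hderiv : ∀ w, AnalyticAt ℂ P w →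
      HasDerivAt (fun w => 1 + w * P w) (P w + w * deriv P w) w := fun w hw => by
    simpa using ((hasDerivAt_id' w).fun_mul hw.differentiableAt.hasDerivAt).const_add 1
  have hev : deriv (fun w => 1 + w * P w) =ᶠ[𝓝 0] fun w => P w + w * deriv P w :=
    hP.eventually_analyticAt.mono fun w hw => (hderiv w hw).deriv
  have hlog : logDeriv (fun w => 1 + w * P w) =ᶠ[𝓝 0]
      fun w => (P w + w * deriv P w) / (1 + w * P w) :=
    hev.mono fun w hw => congrArg (· / (1 + w * P w)) hw
  have hnum := hP.differentiableAt.hasDerivAt.fun_add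
    ((hasDerivAt_id' (0 : ℂ)).fun_mul hP.deriv.differentiableAt.hasDerivAt)
  rw [hlog.deriv_eq, (hnum.fun_div (hderiv 0 hP) (by simp)).deriv]
  simp only [zero_mul, add_zero, one_mul, mul_one, one_pow, div_one]
  ring

theorem classicalSchwarzian_zero_eq {G P : ℂ → ℂ} {c k : ℂ} (hP : AnalyticAt ℂ P 0) (hc : c ≠ 0)
    (hG : G =ᶠ[𝓝 0] fun z => k + c * z / (1 + z * P z)) :
    classicalSchwarzian G 0 = -6 * deriv P 0 := by
  let v : ℂ → ℂ := fun w => 1 + w * P w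
  let Q : ℂ → ℂ := fun w => -(w * deriv P w)
  let N : ℂ → ℂ := fun w => 1 + w * Q w
  have hQ : AnalyticAt ℂ Q 0 := (analyticAt_id.fun_mul hP.deriv).fun_neg
  have hQ' : HasDerivAt Q (-deriv P 0) 0 := by
    simpa using ((hasDerivAt_id' (0 : ℂ)).fun_mul hP.deriv.differentiableAt.hasDerivAt).fun_neg
  have hv : AnalyticAt ℂ v 0 := analyticAt_const.fun_add (analyticAt_id.fun_mul hP)
  have hN : AnalyticAt ℂ N 0 := analyticAt_const.fun_add (analyticAt_id.fun_mul hQ)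
  have hv0 : v 0 ≠ 0 := by simp [v]
  have hN0 : N 0 ≠ 0 := by simp [N]
  have hderiv : deriv G =ᶠ[𝓝 0] fun w => c * (N w / v w ^ 2) := by
    filter_upwards [hG.eventually_nhds, hP.eventually_analyticAt,
      hv.continuousAt.eventually_ne hv0] with w hGw hPw hvw
    have hv' := ((hasDerivAt_id' w).fun_mul hPw.differentiableAt.hasDerivAt).const_add 1
    have hG' := (((hasDerivAt_id' w).const_mul c).fun_div hv' hvw).const_add k
    rw [EventuallyEq.deriv_eq hGw, hG'.deriv]
    simp only [N, Q, v]
    ring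
  have hlog : logDeriv (fun w => c * (N w / v w ^ 2)) =ᶠ[𝓝 0]
      fun w => logDeriv N w - 2 * logDeriv v w := by
    filter_upwards [hv.eventually_analyticAt, hN.eventually_analyticAt,
      hv.continuousAt.eventually_ne hv0, hN.continuousAt.eventually_ne hN0] with w h₁ h₂ h₃ h₄
    rw [logDeriv_const_mul w c hc, logDeriv_div (g := fun w => v w ^ 2) w h₄ (pow_ne_zero 2 h₃)
      h₂.differentiableAt (h₁.differentiableAt.fun_pow 2), logDeriv_fun_pow h₁.differentiableAt,
      Nat.cast_ofNat]
  have hlog' := (differentiableAt_logDeriv hN hN0).hasDerivAt.fun_sub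
    ((differentiableAt_logDeriv hv hv0).hasDerivAt.const_mul 2)
  rw [classicalSchwarzian_eq_of_deriv_eventuallyEq hderiv, hlog.deriv_eq, hlog.eq_of_nhds,
    hlog'.deriv, deriv_logDeriv_one_add_mul_self_zero hP, deriv_logDeriv_one_add_mul_self_zero hQ,
    logDeriv_one_add_mul_self_zero hP.differentiableAt,
    logDeriv_one_add_mul_self_zero hQ.differentiableAt, hQ'.deriv]
  simp only [Q, zero_mul, neg_zero]
  ring

theorem deriv_ne_zero_of_injOn {F : ℂ → ℂ} {U : Set ℂ} (hU : IsOpen U)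
    (hF : DifferentiableOn ℂ F U) (hinj : InjOn F U) (hz : z ∈ U) : deriv F z ≠ 0 := by
  have hJ := jacobian_ne_zero_of_injOn (g := fun _ => 0) hU hF (differentiableOn_const 0)
    (by simpa using hinj) hz
  simpa [jacobian] using hJ

theorem dslope_ne_zero_of_injOn {F : ℂ → ℂ} {U : Set ℂ} (hU : IsOpen U)
    (hF : DifferentiableOn ℂ F U) (hinj : InjOn F U) {a : ℂ} (ha : a ∈ U) (hz : z ∈ U) :
    dslope F a z ≠ 0 := by
  rcases eq_or_ne z a with rfl | hza
  · simpa using deriv_ne_zero_of_injOn hU hF hinj hz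
  · intro h0
    have hsub := sub_smul_dslope F a z
    rw [h0, smul_zero] at hsub
    exact hza (hinj hz ha (sub_eq_zero.1 hsub.symm))

theorem exists_eq_add_div_one_add_mul_of_injOn {G : ℂ → ℂ} {U : Set ℂ} (hU : IsOpen U)
    (h0 : 0 ∈ U) (hG : DifferentiableOn ℂ G U) (hinj : InjOn G U) :
    ∃ P : ℂ → ℂ, DifferentiableOn ℂ P U ∧
      ∀ z ∈ U, 1 + z * P z ≠ 0 ∧ G z = G 0 + deriv G 0 * z / (1 + z * P z) := by
  have hU0 : U ∈ 𝓝 0 := hU.mem_nhds h0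
  have hne : ∀ z ∈ U, dslope G 0 z ≠ 0 := fun z hz => dslope_ne_zero_of_injOn hU hG hinj h0 hz
  have hc : deriv G 0 ≠ 0 := deriv_ne_zero_of_injOn hU hG hinj h0
  let v : ℂ → ℂ := fun z => deriv G 0 / dslope G 0 z
  have hv : DifferentiableOn ℂ v U :=
    (differentiableOn_const _).fun_div ((differentiableOn_dslope hU0).2 hG) hne
  refine ⟨dslope v 0, (differentiableOn_dslope hU0).2 hv, fun z hz => ?_⟩
  have hvz : 1 + z * dslope v 0 z = deriv G 0 / dslope G 0 z := by
    have hsub : z * dslope v 0 z = v z - v 0 := by simpa using sub_smul_dslope v 0 z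
    have hv0 : v 0 = 1 := by simp [v, hc]
    rw [hsub, hv0, add_sub_cancel]
  rw [hvz]
  refine ⟨div_ne_zero hc (hne z hz), ?_⟩
  have hsub : z * dslope G 0 z = G z - G 0 := by simpa using sub_smul_dslope G 0 z
  rw [mul_comm, mul_div_assoc, div_div_cancel₀ hc, hsub, add_sub_cancel]

theorem norm_classicalSchwarzian_zero_le {G : ℂ → ℂ} (hG : DifferentiableOn ℂ G (ball 0 1))
    (hinj : InjOn G (ball 0 1)) : ‖classicalSchwarzian G 0‖ ≤ 6 := by
  have h0 : (0 : ℂ) ∈ ball 0 1 := mem_ball_self one_pos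
  have hc : deriv G 0 ≠ 0 := deriv_ne_zero_of_injOn isOpen_ball hG hinj h0
  obtain ⟨P, hP, hGP⟩ := exists_eq_add_div_one_add_mul_of_injOn isOpen_ball h0 hG hinj
  have hinv : ∀ z ∈ ball 0 1 \ {0}, z⁻¹ + P z = deriv G 0 / (G z - G 0) := fun z hz => by
    have hz0 : z ≠ 0 := hz.2
    rw [sub_eq_of_eq_add' (hGP z hz.1).2]
    field_simp
  have hinjP : InjOn (fun z => z⁻¹ + P z) (ball 0 1 \ {0}) := fun x hx y hy hxy => by
    beta_reduce at hxy
    rw [hinv x hx, hinv y hy, div_eq_mul_inv, div_eq_mul_inv, mul_right_inj' hc, inv_inj,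
      sub_left_inj] at hxy
    exact hinj hx.1 hy.1 hxy
  have hball : ball (0 : ℂ) 1 ∈ 𝓝 0 := ball_mem_nhds 0 one_pos
  rw [classicalSchwarzian_zero_eq (hP.analyticAt hball) hc
    (eventually_of_mem hball fun z hz => (hGP z hz).2), norm_mul, norm_neg]
  calc ‖(6 : ℂ)‖ * ‖deriv P 0‖ ≤ ‖(6 : ℂ)‖ * 1 := by
        gcongr
        exact norm_deriv_le_one_of_injOn_inv_add hP hinjP
    _ = 6 := by norm_num

/-- The conformal automorphism of the unit disk, for `a` in the disk, that moves `0` to `a`. -/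
noncomputable def diskAut (a z : ℂ) : ℂ :=
  (z + a) / (conj a * z + 1)

theorem diskAut_eq_mobius (a : ℂ) : diskAut a = fun z => (1 * z + a) / (conj a * z + 1) := by
  ext z
  rw [diskAut, one_mul]

theorem conj_mul_add_one_ne_zero {a : ℂ} (ha : ‖a‖ < 1) (hz : ‖z‖ < 1) : conj a * z + 1 ≠ 0 := by
  intro h0
  have hnorm : ‖a‖ * ‖z‖ = 1 := by
    rw [← RCLike.norm_conj a, ← norm_mul, eq_neg_of_add_eq_zero_left h0, norm_neg, norm_one]
  exact (mul_lt_one_of_nonneg_of_lt_one_left (norm_nonneg a) ha hz.le).ne hnorm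

theorem norm_diskAut_lt_one {a : ℂ} (ha : ‖a‖ < 1) (hz : ‖z‖ < 1) : ‖diskAut a z‖ < 1 := by
  rw [diskAut, norm_div, div_lt_one (norm_pos_iff.2 (conj_mul_add_one_ne_zero ha hz))]
  refine lt_of_pow_lt_pow_left₀ 2 (norm_nonneg _) ?_
  have hid : ‖conj a * z + 1‖ ^ 2 - ‖z + a‖ ^ 2 = (1 - ‖a‖ ^ 2) * (1 - ‖z‖ ^ 2) := by
    simp only [← normSq_eq_norm_sq, normSq_apply, add_re, add_im, mul_re, mul_im, conj_re, conj_im,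
      one_re, one_im]
    ring
  have hpos : 0 < (1 - ‖a‖ ^ 2) * (1 - ‖z‖ ^ 2) := mul_pos
    (sub_pos.2 (pow_lt_one₀ (norm_nonneg a) ha two_ne_zero))
    (sub_pos.2 (pow_lt_one₀ (norm_nonneg z) hz two_ne_zero))
  linarith

theorem one_sub_mul_conj_ne_zero {a : ℂ} (ha : ‖a‖ < 1) : 1 - a * conj a ≠ 0 := by
  rw [mul_conj', sub_ne_zero]
  exact_mod_cast (pow_lt_one₀ (norm_nonneg a) ha two_ne_zero).ne'

theorem hasDerivAt_diskAut {a : ℂ} (ha : ‖a‖ < 1) (hz : ‖z‖ < 1) :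
    HasDerivAt (diskAut a) ((1 - a * conj a) / (conj a * z + 1) ^ 2) z := by
  simpa only [diskAut_eq_mobius, one_mul] using
    hasDerivAt_mobius 1 a (conj a) 1 (conj_mul_add_one_ne_zero ha hz)

theorem injOn_diskAut {a : ℂ} (ha : ‖a‖ < 1) : InjOn (diskAut a) (ball 0 1) := by
  intro z hz w hw hzw
  rw [diskAut, diskAut, div_eq_div_iff
    (conj_mul_add_one_ne_zero ha (mem_ball_zero_iff.1 hz))
    (conj_mul_add_one_ne_zero ha (mem_ball_zero_iff.1 hw))] at hzw
  refine mul_left_cancel₀ (one_sub_mul_conj_ne_zero ha) ?_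
  linear_combination hzw

theorem classicalSchwarzian_diskAut {a : ℂ} (ha : ‖a‖ < 1) (hz : ‖z‖ < 1) :
    classicalSchwarzian (diskAut a) z = 0 := by
  have hdet : 1 * 1 - a * conj a ≠ 0 := by simpa using one_sub_mul_conj_ne_zero ha
  rw [diskAut_eq_mobius]
  exact classicalSchwarzian_mobius hdet (conj_mul_add_one_ne_zero ha hz)

theorem norm_classicalSchwarzian_mul_le {F : ℂ → ℂ} (hF : DifferentiableOn ℂ F (ball 0 1))
    (hinj : InjOn F (ball 0 1)) {a : ℂ} (ha : ‖a‖ < 1) :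
    ‖classicalSchwarzian F a‖ * (1 - ‖a‖ ^ 2) ^ 2 ≤ 6 := by
  have hmaps : MapsTo (diskAut a) (ball 0 1) (ball 0 1) := fun z hz =>
    mem_ball_zero_iff.2 (norm_diskAut_lt_one ha (mem_ball_zero_iff.1 hz))
  have hdiff : DifferentiableOn ℂ (diskAut a) (ball 0 1) := fun z hz =>
    (hasDerivAt_diskAut ha (mem_ball_zero_iff.1 hz)).differentiableAt.differentiableWithinAt
  have hzero : diskAut a 0 = a := by simp [diskAut]
  have hderiv : deriv (diskAut a) 0 = 1 - a * conj a := by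
    simpa using (hasDerivAt_diskAut ha (norm_zero.trans_lt one_pos)).deriv
  have haball : a ∈ ball (0 : ℂ) 1 := mem_ball_zero_iff.2 ha
  have hcomp : classicalSchwarzian (F ∘ diskAut a) 0 =
      classicalSchwarzian F a * (1 - a * conj a) ^ 2 := by
    rw [classicalSchwarzian_comp (hdiff.analyticAt (ball_mem_nhds 0 one_pos))
      (hzero.symm ▸ hF.analyticAt (isOpen_ball.mem_nhds haball))
      (hderiv.symm ▸ one_sub_mul_conj_ne_zero ha)
      (hzero.symm ▸ deriv_ne_zero_of_injOn isOpen_ball hF hinj haball), hzero, hderiv,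
      classicalSchwarzian_diskAut ha (norm_zero.trans_lt one_pos), add_zero]
  have hle := norm_classicalSchwarzian_zero_le (hF.comp hdiff hmaps)
    (hinj.comp (injOn_diskAut ha) hmaps)
  have hnorm : ‖1 - a * conj a‖ = 1 - ‖a‖ ^ 2 := by
    have hpos : 0 ≤ 1 - ‖a‖ ^ 2 := sub_nonneg.2 (pow_le_one₀ (norm_nonneg a) ha.le)
    rw [mul_conj', ← Complex.norm_of_nonneg hpos]
    push_cast
    rfl
  rwa [hcomp, norm_mul, norm_pow, hnorm] at hle

/-! ### Schwarzian derivatives of harmonic mappings -/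

theorem norm_dilatation_lt_one (hJ : 0 < jacobian h g z) : ‖dilatation h g z‖ < 1 := by
  have hlt : ‖deriv g z‖ < ‖deriv h z‖ := lt_of_pow_lt_pow_left₀ 2 (norm_nonneg _) (sub_pos.1 hJ)
  rwa [dilatation, norm_div, div_lt_one ((norm_nonneg _).trans_lt hlt)]

theorem deriv_ne_zero_of_jacobian_pos (hJ : 0 < jacobian h g z) : deriv h z ≠ 0 := by
  intro h0
  rw [jacobian, h0, norm_zero] at hJ
  linarith [sq_nonneg ‖deriv g z‖]

theorem analyticAt_dilatation (hh : AnalyticAt ℂ h z) (hg : AnalyticAt ℂ g z)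
    (hh' : deriv h z ≠ 0) : AnalyticAt ℂ (dilatation h g) z :=
  hg.deriv.fun_div hh.deriv hh'

theorem classicalSchwarzian_add_mul (hh : AnalyticAt ℂ h z) (hg : AnalyticAt ℂ g z)
    (hh' : deriv h z ≠ 0) {a : ℂ} (ha : 1 + a * dilatation h g z ≠ 0) :
    classicalSchwarzian (fun w => h w + a * g w) z = classicalSchwarzian h z
      + a / (1 + a * dilatation h g z) *
        (deriv (deriv (dilatation h g)) z - preSchwarzian h z * deriv (dilatation h g) z)
      - 3 / 2 * (a * deriv (dilatation h g) z / (1 + a * dilatation h g z)) ^ 2 := by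
  have hω := analyticAt_dilatation hh hg hh'
  have hφ' : ∀ w, AnalyticAt ℂ (dilatation h g) w →
      HasDerivAt (fun w => 1 + a * dilatation h g w) (a * deriv (dilatation h g) w) w :=
    fun w hw => (hw.differentiableAt.hasDerivAt.const_mul a).const_add 1
  have hφ : AnalyticAt ℂ (fun w => 1 + a * dilatation h g w) z :=
    analyticAt_const.fun_add (analyticAt_const.fun_mul hω)
  have hF : deriv (fun w => h w + a * g w) =ᶠ[𝓝 z]
      fun w => deriv h w * (1 + a * dilatation h g w) := by
    filter_upwards [hh.eventually_analyticAt, hg.eventually_analyticAt,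
      hh.deriv.continuousAt.eventually_ne hh'] with w hhw hgw hh'w
    rw [deriv_fun_add hhw.differentiableAt (hgw.differentiableAt.const_mul a),
      deriv_const_mul_field, dilatation]
    field_simp
  have hlog : logDeriv (fun w => 1 + a * dilatation h g w) =ᶠ[𝓝 z]
      fun w => a * deriv (dilatation h g) w / (1 + a * dilatation h g w) :=
    hω.eventually_analyticAt.mono fun w hw => by rw [logDeriv_apply, (hφ' w hw).deriv]
  have hlog' := (hω.deriv.differentiableAt.hasDerivAt.const_mul a).fun_div (hφ' z hω) ha
  rw [classicalSchwarzian_eq_of_deriv_eventuallyEq_mul hh hφ hh' ha hF, hlog.deriv_eq,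
    hlog.eq_of_nhds, hlog'.deriv]
  field_simp
  ring

theorem sensePreservingSchwarzian_eq_classicalSchwarzian (hh : AnalyticAt ℂ h z)
    (hg : AnalyticAt ℂ g z) (hJ : 0 < jacobian h g z) :
    sensePreservingSchwarzian h g z =
      classicalSchwarzian (fun w => h w + -conj (dilatation h g z) * g w) z := by
  have hone : 1 + -conj (dilatation h g z) * dilatation h g z =
      1 - (‖dilatation h g z‖ : ℂ) ^ 2 := by
    rw [neg_mul, conj_mul', sub_eq_add_neg]
  have hne : 1 + -conj (dilatation h g z) * dilatation h g z ≠ 0 := by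
    rw [neg_mul, ← sub_eq_add_neg, mul_comm]
    exact one_sub_mul_conj_ne_zero (norm_dilatation_lt_one hJ)
  rw [classicalSchwarzian_add_mul hh hg (deriv_ne_zero_of_jacobian_pos hJ) hne, hone,
    sensePreservingSchwarzian]
  ring

theorem norm_sensePreservingSchwarzian_mul_le (hh : DifferentiableOn ℂ h (ball 0 1))
    (hg : DifferentiableOn ℂ g (ball 0 1)) (hinj : InjOn (fun z => h z + conj (g z)) (ball 0 1))
    (hconv : Convex ℝ ((fun z => h z + conj (g z)) '' ball 0 1))
    (hJ : ∀ z ∈ ball (0 : ℂ) 1, 0 < jacobian h g z) (hz : z ∈ ball (0 : ℂ) 1) :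
    ‖sensePreservingSchwarzian h g z‖ * (1 - ‖z‖ ^ 2) ^ 2 ≤ 6 := by
  have hzn := isOpen_ball.mem_nhds hz
  have ha : ‖-conj (dilatation h g z)‖ < 1 := by
    rw [norm_neg, RCLike.norm_conj]
    exact norm_dilatation_lt_one (hJ z hz)
  rw [sensePreservingSchwarzian_eq_classicalSchwarzian (hh.analyticAt hzn) (hg.analyticAt hzn)
    (hJ z hz)]
  exact norm_classicalSchwarzian_mul_le (hh.fun_add (hg.const_mul _))
    (injOn_add_mul_of_convex_image isOpen_ball hh hg hinj hconv hJ ha) (mem_ball_zero_iff.1 hz)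

theorem jacobian_pos_or_neg {U : Set ℂ} (hU : IsOpen U) (hUc : IsPreconnected U)
    (hh : DifferentiableOn ℂ h U) (hg : DifferentiableOn ℂ g U)
    (hJ : ∀ z ∈ U, jacobian h g z ≠ 0) :
    (∀ z ∈ U, 0 < jacobian h g z) ∨ ∀ z ∈ U, jacobian h g z < 0 := by
  have hcont : ContinuousOn (jacobian h g) U :=
    ((hh.deriv hU).continuousOn.norm.pow 2).sub ((hg.deriv hU).continuousOn.norm.pow 2)
  by_contra! hcon
  obtain ⟨⟨z, hz, hz0⟩, w, hw, hw0⟩ := hcon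
  obtain ⟨x, hx, hx0⟩ := hUc.intermediate_value hz hw hcont ⟨hz0, hw0⟩
  exact hJ x hx hx0

theorem jacobian_swap (h g : ℂ → ℂ) (z : ℂ) : jacobian g h z = -jacobian h g z :=
  (neg_sub _ _).symm

theorem add_conj_swap (h g : ℂ → ℂ) :
    (fun z => g z + conj (h z)) = conj ∘ fun z => h z + conj (g z) := by
  ext z
  simp [add_comm]

theorem norm_schwarzian_mul_le (hh : DifferentiableOn ℂ h (ball 0 1))
    (hg : DifferentiableOn ℂ g (ball 0 1)) (hinj : InjOn (fun z => h z + conj (g z)) (ball 0 1))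
    (hconv : Convex ℝ ((fun z => h z + conj (g z)) '' ball 0 1)) (hz : z ∈ ball (0 : ℂ) 1) :
    ‖schwarzian h g z‖ * (1 - ‖z‖ ^ 2) ^ 2 ≤ 6 := by
  rcases jacobian_pos_or_neg isOpen_ball (convex_ball 0 1).isPreconnected hh hg
    fun w hw => jacobian_ne_zero_of_injOn isOpen_ball hh hg hinj hw with hpos | hneg
  · rw [schwarzian, if_pos (hpos z hz)]
    exact norm_sensePreservingSchwarzian_mul_le hh hg hinj hconv hpos hz
  · rw [schwarzian, if_neg (hneg z hz).not_gt]
    refine norm_sensePreservingSchwarzian_mul_le hg hh ?_ ?_ (fun w hw => ?_) hz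
    · exact add_conj_swap h g ▸ (starRingEnd ℂ).injective.comp_injOn hinj
    · rw [add_conj_swap, image_comp]
      exact hconv.linear_image conjAe.toLinearMap
    · rw [jacobian_swap]
      exact neg_pos.2 (hneg w hw)

end HarmonicSchwarzian

open HarmonicSchwarzian

theorem mainTheorem8 (f h g : ℂ → ℂ)
    (hf : HarmonicSchwarzian.IsConvexHarmonicMapping f)
    (hfhg : HarmonicSchwarzian.IsRepresentation f h g) :
    (∀ z ∈ Metric.ball (0 : ℂ) 1, HarmonicSchwarzian.jacobian h g z ≠ 0) ∧
      HarmonicSchwarzian.schwarzianNorm h g ≤ 6 := by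
  obtain ⟨hh, hg, heq⟩ := hfhg
  have heqOn : Set.EqOn f (fun z => h z + starRingEnd ℂ (g z)) (Metric.ball 0 1) := heq
  have hinj := hf.univalent.congr heqOn
  have hconv := heqOn.image_eq ▸ hf.convex_image
  refine ⟨fun z => jacobian_ne_zero_of_injOn Metric.isOpen_ball hh hg hinj,
    iSup₂_le fun z hz => ?_⟩
  calc ENNReal.ofReal (‖schwarzian h g z‖ * (1 - ‖z‖ ^ 2) ^ 2)
      ≤ ENNReal.ofReal 6 := ENNReal.ofReal_le_ofReal (norm_schwarzian_mul_le hh hg hinj hconv hz)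
    _ = 6 := by norm_num
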